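/- Let $N\ge 2$, let $q\in\mathbb R\setminus\{-1,0,1\}$, and put $Q=q-q^{-1}$, $s_0=\sum_{i=1}^{N-1}q^{2i}$. Let $X$ be the coordinate algebra of the quantum sphere $\mathrm S_q^{2N-1}$: the unital complex algebra with generators $z_i,z_i^*$ ($1\le i\le N$) and relations $$z_iz_j=qz_jz_i,\quad z_i^*z_j^*=q^{-1}z_j^*z_i^*\ (i<j),\qquad z_iz_j^*=qz_j^*z_i\ (i\ne j),$$ $$z_iz_i^*-z_i^*z_i+q^{-1}Q\sum_{k>i}z_kz_k^*=0,\qquad \sum_i z_iz_i^*=1.$$ A first order differential calculus on $X$ is an $X$-bimodule $\Gamma$ with a linear map $\mathrm d:X\to\Gamma$ such that $\mathrm d(xy)=(\mathrm dx)y+x\,\mathrm dy$ and $\Gamma=\mathrm{Lin}\{x\,\mathrm dy\mid x,y\in X\}$. It is called inner if there is $\omega\in\Gamma$ with $\mathrm dx=\omega x-x\omega$ for all $x\in X$. Put $H_+=\sum_i z_i\,\mathrm dz_i^*$, $H_-=\sum_i q^{-2i}z_i^*\,\mathrm dz_i$. Let $R^{ij}_{kl}=1$ if $i=l\ne k=j$;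 $=q$ if $i=j=k=l$; $=Q$ if $i=k<j=l$; $=0$ otherwise; and let $(R^-)^{ij}_{kl}=1$ if $i=l\ne k=j$; $=q^{-1}$ if $i=j=k=l$; $=-Q$ if $i=k>j=l$; $=0$ otherwise. Let $\check R^{ij}_{kl}=R^{lk}_{ji}$, $L^{ij}_{kl}=q^{2l-2i}(R^-)^{jl}_{ik}$, $P^{ij}_{kl}=R^{ki}_{lj}$. Consider bimodule structures of the form (sums over $s,t$) \begin{align*} \mathrm dz_k\,z_l&=a_1(R^-)^{st}_{kl}z_s\mathrm dz_t+b_1z_k\mathrm dz_l+c_1z_kz_lH_1,\\ \mathrm dz_k^*\,z_l^*&=a_2\check R^{st}_{kl}z_s^*\mathrm dz_t^*+b_2z_k^*\mathrm dz_l^*+c_2z_k^*z_l^*H_1,\\ \mathrm dz_k\,z_l^*&=a_3L^{st}_{kl}z_s^*\mathrm dz_t+b_3z_k\mathrm dz_l^*+c_3z_kz_l^*H_1+d_3q^{2k}\delta_{kl}H_1,\\ \mathrm dz_k^*\,z_l&=a_4P^{st}_{kl}z_s\mathrm dz_t^*+b_4z_k^*\mathrm dz_l+c_4z_k^*z_lH_1+d_4\delta_{kl}H_1,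 \end{align*} with a left module relation $H_0=0$. Here $H_0=H_++\lambda H_-$ for $\lambda\in\mathbb C$, $H_0=H_-$ for $\lambda=\infty$; $H_1=H_+$, except that $H_1=H_-$ for $\tilde\Gamma''_0$. The calculi are the following; coefficients not listed are $0$. * $\tilde\Gamma_\lambda$ ($\lambda\in\mathbb C\setminus\{0,q^2\}$): $a_1=a_4=q\lambda^{-1}$, $a_2=a_3=q^{-1}\lambda$, $b_1=b_3=q^2\lambda^{-1}-1$, $b_2=b_4=q^{-2}\lambda-1$, $c_1=q^2\lambda^{-1}(\lambda^{-1}-1)$, $c_2=-(\lambda-1)$, $c_3=c_4=-(q^2\lambda^{-1}-1)$. * $\tilde\Gamma'_\lambda$ ($\lambda\in\mathbb C\setminus\{0\}$): $a_1=a_4=q^{-1}$, $a_2=a_3=q$, $c_1=-\lambda^{-1}(q^4\lambda^{-1}-1)$, $c_2=-q^{-2}\lambda(q^4\lambda^{-1}-1)$, $c_3=c_4=q^2\lambda^{-1}-1$. * $\tilde\Gamma''_\lambda$ ($\lambda\in\mathbb C\cup\{\infty\}$): $a_1=a_4=q^{-1}$, $a_2=a_3=q$, $d_4=q^{2N}d_3$,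 and for $\lambda\ne0,\infty$: $c_3=c_4=-s_0^{-1}(q^{2N+2}\lambda^{-1}-1)$, $d_3=q^{-2}s_0^{-1}(q^4\lambda^{-1}-1)$; for $\lambda=0$: $c_3=c_4=q^{2N+2}s_0^{-1}$, $d_3=-q^{2}s_0^{-1}$; for $\lambda=\infty$: $c_3=c_4=s_0^{-1}$, $d_3=-q^{-2}s_0^{-1}$. * $\tilde\Gamma^{(1)}_\lambda$ ($\lambda\in\mathbb C\setminus\{0,q^2\}$): $a_1=q\lambda^{-1}$, $a_2=q$, $a_3=q^{-1}\lambda$, $a_4=q^{-1}$, $b_1=q^2\lambda^{-1}-1$, $b_4=q^{-2}\lambda-1$, $c_1=q^2\lambda^{-1}(\lambda^{-1}-1)$, $c_2=-q^{-2}\lambda(q^4\lambda^{-1}-1)$. * $\tilde\Gamma^{(2)}_\lambda$ ($\lambda\in\mathbb C\setminus\{0,q^2\}$): $a_1=q^{-1}$, $a_2=q^{-1}\lambda$, $a_3=q$, $a_4=q\lambda^{-1}$, $b_2=q^{-2}\lambda-1$, $b_3=q^2\lambda^{-1}-1$, $c_1=-\lambda^{-1}(q^4\lambda^{-1}-1)$,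 $c_2=-(\lambda-1)$. Each of these names denotes the calculus generated by these relations, i.e. the quotient of the universal first order differential calculus on $X$ by the sub-bimodule generated by $H_0$ and by the differences of both sides of the bimodule relations. A calculus $(\Gamma,\mathrm d)$ is said to be of the given type if it satisfies these bimodule relations and if the relations $\sum_i x_i\,\mathrm dz_i+\sum_i y_i\,\mathrm dz_i^*=0$ ($x_i,y_i\in X$) that hold in the left module $\Gamma$ are exactly the left multiples $pH_0=0$, $p\in X$, of $H_0=0$. Then the calculus $\tilde\Gamma_\lambda$, and every calculus of this type, is inner, with $$\mathrm dx=Hx-xH\quad\text{for all }x\in X,\qquad H=(q^{-2}\lambda-1)^{-1}H_+ .$$ None of the calculi $\tilde\Gamma'_\lambda,\tilde\Gamma''_\lambda,\tilde\Gamma^{(1)}_\lambda,\tilde\Gamma^{(2)}_\lambda$, and no calculus of one of these types, is inner. -/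

import Mathlib

universe u v

noncomputable section

namespace QuantumSphere

open scoped TensorProduct RightActions

/-! ### First order differential calculi -/

/-- A first order differential calculus `(Γ, d)` on a complex unital algebra `X`: an `X`-bimodule
`Γ` (left multiplication `x •> ω`, right multiplication `ω <• x`, with compatible complex scalars)
and a linear map `d : X → Γ` obeying the Leibniz rule, such that `Γ = Lin {x dy | x, y ∈ X}`. -/
structure FODC (X : Type u) [Ring X] [Algebra ℂ X] where
  Form : Type v
  [addCommGroup : AddCommGroup Form]
  [module : Module ℂ Form]
  [leftModule : Module X Form]
  [rightModule : Module Xᵐᵒᵖ Form]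
  [smulComm : SMulCommClass X Xᵐᵒᵖ Form]
  [leftTower : IsScalarTower ℂ X Form]
  [rightTower : IsScalarTower ℂ Xᵐᵒᵖ Form]
  d : X →ₗ[ℂ] Form
  leibniz : ∀ x y : X, d (x * y) = d x <• y + x •> d y
  span_eq_top : Submodule.span ℂ {ω : Form | ∃ x y : X, ω = x •> d y} = ⊤

attribute [instance] FODC.addCommGroup FODC.module FODC.leftModule FODC.rightModule
  FODC.smulComm FODC.leftTower FODC.rightTower

namespace FODC

variable {X : Type u} [Ring X] [Algebra ℂ X]

/-- The calculus is inner with respect to the one-form `ω`: `dx = ωx - xω` for all `x`. -/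
def IsInnerBy (C : FODC.{u, v} X) (ω : C.Form) : Prop :=
  ∀ x : X, C.d x = ω <• x - x •> ω

/-- The calculus is inner: `dx = ωx - xω` for all `x`, for some one-form `ω`. -/
def IsInner (C : FODC.{u, v} X) : Prop :=
  ∃ ω : C.Form, C.IsInnerBy ω

/-- The enveloping algebra of `X`; its left modules are the `X`-bimodules
(with `ℂ` acting centrally), `(x ⊗ y) ω = x ω y`. -/
abbrev Env (X : Type u) [Ring X] [Algebra ℂ X] : Type u := X ⊗[ℂ] Xᵐᵒᵖ

/-- The calculus given by a module over the enveloping algebra, read as an `X`-bimodule. -/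
def ofEnv (M : Type v) [AddCommGroup M] [Module (Env X) M] (δ : X → M)
    (hadd : ∀ x y, δ (x + y) = δ x + δ y)
    (hsmul : ∀ (c : ℂ) x, δ (c • x) = algebraMap ℂ (Env X) c • δ x)
    (hmul : ∀ x y, δ (x * y) =
      ((1 : X) ⊗ₜ[ℂ] MulOpposite.op y : Env X) • δ x +
        (x ⊗ₜ[ℂ] (1 : Xᵐᵒᵖ) : Env X) • δ y)
    (hgen : ∀ ω : M, ω ∈ AddSubgroup.closure
      {ω : M | ∃ x y : X, ω = (x ⊗ₜ[ℂ] (1 : Xᵐᵒᵖ) : Env X) • δ y}) :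
    FODC.{u, v} X :=
  letI i1 : Module ℂ M := Module.compHom M (algebraMap ℂ (Env X))
  letI i2 : Module X M := Module.compHom M
    (Algebra.TensorProduct.includeLeft : X →ₐ[ℂ] Env X).toRingHom
  letI i3 : Module Xᵐᵒᵖ M := Module.compHom M
    (Algebra.TensorProduct.includeRight : Xᵐᵒᵖ →ₐ[ℂ] Env X).toRingHom
  { Form := M
    module := i1
    leftModule := i2
    rightModule := i3
    smulComm := ⟨fun x y m => by
      change (x ⊗ₜ[ℂ] (1 : Xᵐᵒᵖ) : Env X) • ((1 : X) ⊗ₜ[ℂ] y : Env X) • m =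
        ((1 : X) ⊗ₜ[ℂ] y : Env X) • (x ⊗ₜ[ℂ] (1 : Xᵐᵒᵖ) : Env X) • m
      simp [smul_smul]⟩
    leftTower := ⟨fun c x m => by
      change ((c • x) ⊗ₜ[ℂ] (1 : Xᵐᵒᵖ) : Env X) • m =
        algebraMap ℂ (Env X) c • (x ⊗ₜ[ℂ] (1 : Xᵐᵒᵖ) : Env X) • m
      rw [smul_smul, ← Algebra.smul_def, TensorProduct.smul_tmul']⟩
    rightTower := ⟨fun c x m => by
      change ((1 : X) ⊗ₜ[ℂ] (c • x) : Env X) • m =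
        algebraMap ℂ (Env X) c • ((1 : X) ⊗ₜ[ℂ] x : Env X) • m
      rw [smul_smul, ← Algebra.smul_def, TensorProduct.tmul_smul]⟩
    d := { toFun := δ, map_add' := hadd, map_smul' := hsmul }
    leibniz := hmul
    span_eq_top := by
      rw [eq_top_iff]
      intro ω _
      exact (AddSubgroup.closure_le (Submodule.toAddSubgroup (Submodule.span ℂ
        {ω : M | ∃ x y : X, ω = x •> δ y}))).2
        (fun η hη => Submodule.subset_span hη) (hgen ω) }

/-- The bimodule `Ω` of universal one-forms: the sub-bimodule of `X ⊗ X` (outer bimodule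
structure) generated by the elements `1 ⊗ x - x ⊗ 1`. -/
def universalForms (X : Type u) [Ring X] [Algebra ℂ X] : Submodule (Env X) (Env X) :=
  Submodule.span (Env X) (Set.range fun x : X =>
    ((1 : X) ⊗ₜ[ℂ] MulOpposite.op x - x ⊗ₜ[ℂ] (1 : Xᵐᵒᵖ) : Env X))

/-- The universal differential `x ↦ 1 ⊗ x - x ⊗ 1`. -/
def universalD (X : Type u) [Ring X] [Algebra ℂ X] (x : X) : universalForms X :=
  ⟨(1 : X) ⊗ₜ[ℂ] MulOpposite.op x - x ⊗ₜ[ℂ] (1 : Xᵐᵒᵖ), Submodule.subset_span ⟨x, rfl⟩⟩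

theorem universalD_mul (x y : X) : universalD X (x * y) =
    ((1 : X) ⊗ₜ[ℂ] MulOpposite.op y : Env X) • universalD X x +
      (x ⊗ₜ[ℂ] (1 : Xᵐᵒᵖ) : Env X) • universalD X y := by
  apply Subtype.ext
  change (1 : X) ⊗ₜ[ℂ] MulOpposite.op (x * y) - (x * y) ⊗ₜ[ℂ] (1 : Xᵐᵒᵖ) =
    ((1 : X) ⊗ₜ[ℂ] MulOpposite.op y : Env X) *
        ((1 : X) ⊗ₜ[ℂ] MulOpposite.op x - x ⊗ₜ[ℂ] (1 : Xᵐᵒᵖ)) +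
      (x ⊗ₜ[ℂ] (1 : Xᵐᵒᵖ) : Env X) *
        ((1 : X) ⊗ₜ[ℂ] MulOpposite.op y - y ⊗ₜ[ℂ] (1 : Xᵐᵒᵖ))
  simp [mul_sub]

/-- In a module over the enveloping algebra that is generated by the image of a derivation `δ`,
every element is a sum of elements `x δ(y)`. -/
theorem mem_closure_of_span {M : Type v} [AddCommGroup M] [Module (Env X) M] (δ : X → M)
    (hmul : ∀ x y, δ (x * y) =
      ((1 : X) ⊗ₜ[ℂ] MulOpposite.op y : Env X) • δ x +
        (x ⊗ₜ[ℂ] (1 : Xᵐᵒᵖ) : Env X) • δ y)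
    (hspan : Submodule.span (Env X) (Set.range δ) = ⊤) (ω : M) :
    ω ∈ AddSubgroup.closure
      {ω : M | ∃ x y : X, ω = (x ⊗ₜ[ℂ] (1 : Xᵐᵒᵖ) : Env X) • δ y} := by
  have key : ∀ (e : Env X) (y : X), e • δ y ∈ AddSubgroup.closure
      {ω : M | ∃ x y : X, ω = (x ⊗ₜ[ℂ] (1 : Xᵐᵒᵖ) : Env X) • δ y} := by
    intro e y
    induction e using TensorProduct.induction_on with
    | zero =>
      have h0 : (0 : Env X) • δ y = 0 := zero_smul (Env X) (δ y)
      exact h0.symm ▸ zero_mem _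
    | tmul a b =>
      have h : (a ⊗ₜ[ℂ] b : Env X) • δ y =
          (a ⊗ₜ[ℂ] (1 : Xᵐᵒᵖ) : Env X) • δ (y * b.unop) -
            ((a * y) ⊗ₜ[ℂ] (1 : Xᵐᵒᵖ) : Env X) • δ b.unop := by
        rw [hmul, smul_add, smul_smul, smul_smul]
        simp
      rw [h]
      exact sub_mem (AddSubgroup.subset_closure ⟨_, _, rfl⟩)
        (AddSubgroup.subset_closure ⟨_, _, rfl⟩)
    | add e f he hf =>
      rw [add_smul]
      exact add_mem he hf
  have hω : ω ∈ Submodule.span (Env X) (Set.range δ) := hspan ▸ Submodule.mem_top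
  induction hω using Submodule.closure_induction with
  | zero => exact zero_mem _
  | add a b _ _ ha hb => exact add_mem ha hb
  | smul_mem r x hx =>
    obtain ⟨y, rfl⟩ := hx
    exact key r y

/-- The universal first order differential calculus on `X`. -/
def universal (X : Type u) [Ring X] [Algebra ℂ X] : FODC.{u, u} X :=
  ofEnv (universalForms X) (universalD X)
    (fun x y => by
      apply Subtype.ext
      simp only [universalD, MulOpposite.op_add, TensorProduct.tmul_add, TensorProduct.add_tmul,
        Submodule.coe_add]
      abel)
    (fun c x => by
      apply Subtype.ext
      change (1 : X) ⊗ₜ[ℂ] MulOpposite.op (c • x) - (c • x) ⊗ₜ[ℂ] (1 : Xᵐᵒᵖ) =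
        algebraMap ℂ (Env X) c * ((1 : X) ⊗ₜ[ℂ] MulOpposite.op x - x ⊗ₜ[ℂ] (1 : Xᵐᵒᵖ))
      rw [← Algebra.smul_def, smul_sub, MulOpposite.op_smul, TensorProduct.tmul_smul,
        TensorProduct.smul_tmul' c x (1 : Xᵐᵒᵖ)])
    universalD_mul
    (mem_closure_of_span _ universalD_mul (by
      apply Submodule.map_injective_of_injective (universalForms X).injective_subtype
      rw [Submodule.map_span, Submodule.map_top, Submodule.range_subtype, ← Set.range_comp]
      rfl))

/-- A bimodule of one-forms as a module over the enveloping algebra, `(x ⊗ y) ω = x ω y`. -/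
@[reducible]
def envModule (C : FODC.{u, v} X) : Module (Env X) C.Form :=
  TensorProduct.Algebra.module

/-- The quotient of a calculus by the sub-bimodule generated by a set `S` of one-forms. -/
def quotient (C : FODC.{u, v} X) (S : Set C.Form) : FODC.{u, v} X :=
  letI := C.envModule
  have hmul : ∀ x y, Submodule.Quotient.mk (p := Submodule.span (Env X) S) (C.d (x * y)) =
      ((1 : X) ⊗ₜ[ℂ] MulOpposite.op y : Env X) • Submodule.Quotient.mk (C.d x) +
        (x ⊗ₜ[ℂ] (1 : Xᵐᵒᵖ) : Env X) • Submodule.Quotient.mk (C.d y) := fun x y => by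
    rw [C.leibniz, ← Submodule.Quotient.mk_smul, ← Submodule.Quotient.mk_smul,
      ← Submodule.Quotient.mk_add, TensorProduct.Algebra.smul_def, TensorProduct.Algebra.smul_def,
      one_smul, one_smul]
  ofEnv (C.Form ⧸ Submodule.span (Env X) S) (fun x => Submodule.Quotient.mk (C.d x))
    (fun x y => by rw [map_add, Submodule.Quotient.mk_add])
    (fun c x => by
      rw [map_smul, ← Submodule.Quotient.mk_smul, Algebra.TensorProduct.algebraMap_apply,
        TensorProduct.Algebra.smul_def, one_smul, algebraMap_smul])
    hmul
    (mem_closure_of_span _ hmul (by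
      have hC : Submodule.span (Env X) (Set.range C.d) = ⊤ := by
        rw [eq_top_iff]
        rintro ω -
        have hω : ω ∈ Submodule.span ℂ {ω : C.Form | ∃ x y : X, ω = x •> C.d y} :=
          C.span_eq_top ▸ Submodule.mem_top
        induction hω using Submodule.closure_induction with
        | zero => exact zero_mem _
        | add a b _ _ ha hb => exact add_mem ha hb
        | smul_mem c η hη =>
          obtain ⟨x, y, rfl⟩ := hη
          have h : c • x •> C.d y = ((c • x) ⊗ₜ[ℂ] (1 : Xᵐᵒᵖ) : Env X) • C.d y := by
            rw [TensorProduct.Algebra.smul_def, one_smul, smul_assoc]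
          rw [h]
          exact Submodule.smul_mem _ _ (Submodule.subset_span ⟨y, rfl⟩)
      have h := congrArg (Submodule.map (Submodule.span (Env X) S).mkQ) hC
      rw [Submodule.map_span, ← Set.range_comp, Submodule.map_top, Submodule.range_mkQ] at h
      exact h))

end FODC

/-! ### The quantum sphere -/

/-- The `2N` generators `z_i`, `z_i^*`. The index `i : Fin N` stands for the number `i + 1`
in `{1, …, N}`. -/
inductive Gen (N : ℕ) : Type
  | z (i : Fin N)
  | zs (i : Fin N)

/-- The free generator `z_i`. -/
abbrev fz {N : ℕ} (i : Fin N) : FreeAlgebra ℂ (Gen N) := FreeAlgebra.ι ℂ (Gen.z i)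

/-- The free generator `z_i^*`. -/
abbrev fzs {N : ℕ} (i : Fin N) : FreeAlgebra ℂ (Gen N) := FreeAlgebra.ι ℂ (Gen.zs i)

/-- The number `Q = q - q⁻¹`. -/
def bigQ (q : ℂ) : ℂ := q - q⁻¹

/-- The defining relations of the quantum sphere. -/
inductive SphereRel (N : ℕ) (q : ℂ) : FreeAlgebra ℂ (Gen N) → FreeAlgebra ℂ (Gen N) → Prop
  | zz (i j : Fin N) (h : i < j) : SphereRel N q (fz i * fz j) (q • (fz j * fz i))
  | zszs (i j : Fin N) (h : i < j) : SphereRel N q (fzs i * fzs j) (q⁻¹ • (fzs j * fzs i))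
  | zzs (i j : Fin N) (h : i ≠ j) : SphereRel N q (fz i * fzs j) (q • (fzs j * fz i))
  | diag (i : Fin N) : SphereRel N q
      (fz i * fzs i - fzs i * fz i + (q⁻¹ * bigQ q) • ∑ k ∈ Finset.Ioi i, fz k * fzs k) 0
  | sphere : SphereRel N q (∑ i, fz i * fzs i) 1

/-- The coordinate algebra `X` of the quantum sphere `S_q^{2N-1}`. -/
abbrev Sphere (N : ℕ) (q : ℂ) : Type := RingQuot (SphereRel N q)

/-- The generator `z_i` of `X`. -/
def z {N : ℕ} {q : ℂ} (i : Fin N) : Sphere N q := RingQuot.mkAlgHom ℂ (SphereRel N q) (fz i)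

/-- The generator `z_i^*` of `X`. -/
def zs {N : ℕ} {q : ℂ} (i : Fin N) : Sphere N q := RingQuot.mkAlgHom ℂ (SphereRel N q) (fzs i)

/-! ### R-matrices -/

section RMatrices

variable {N : ℕ} (q : ℂ)

/-- `R^{ij}_{kl}`. -/
def R (i j k l : Fin N) : ℂ :=
  if i = l ∧ k = j ∧ i ≠ k then 1
  else if i = j ∧ j = k ∧ k = l then q
  else if i = k ∧ j = l ∧ i < j then bigQ q
  else 0

/-- `(R⁻¹)^{ij}_{kl}`. -/
def Rinv (i j k l : Fin N) : ℂ :=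
  if i = l ∧ k = j ∧ i ≠ k then 1
  else if i = j ∧ j = k ∧ k = l then q⁻¹
  else if i = k ∧ j = l ∧ j < i then -bigQ q
  else 0

/-- `Rc^{ij}_{kl} = R^{lk}_{ji}`. -/
def Rc (i j k l : Fin N) : ℂ := R q l k j i

/-- `Rl⁻^{ij}_{kl} = q^{2l-2i} (R⁻¹)^{jl}_{ik}`. -/
def Rlinv (i j k l : Fin N) : ℂ := q ^ (2 * (l : ℤ) - 2 * (i : ℤ)) * Rinv q j l i k

/-- `Rr^{ij}_{kl} = R^{ki}_{lj}`. -/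
def Rr (i j k l : Fin N) : ℂ := R q k i l j

end RMatrices

/-- The number `s₀ = q² + q⁴ + ⋯ + q^{2(N-1)}`. -/
def s0 (N : ℕ) (q : ℂ) : ℂ := (∑ i ∈ Finset.range N, q ^ (2 * i)) - 1

/-! ### The five families of calculi -/

/-- Names for the calculi `Γ̃_λ`, `Γ̃'_λ`, `Γ̃''_λ`, `Γ̃''_∞`, and the two further families
(here `Γ̃⁽¹⁾_λ` and `Γ̃⁽²⁾_λ`). -/
inductive CalcName : Type
  | tilde (l : ℂ)
  | prime (l : ℂ)
  | doublePrime (l : ℂ)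
  | doublePrimeInfty
  | first (l : ℂ)
  | second (l : ℂ)

/-- The admissible parameters of the calculi. -/
def CalcName.Admissible (q : ℂ) : CalcName → Prop
  | .tilde l => l ≠ 0 ∧ l ≠ q ^ 2
  | .prime l => l ≠ 0
  | .doublePrime _ => True
  | .doublePrimeInfty => True
  | .first l => l ≠ 0 ∧ l ≠ q ^ 2
  | .second l => l ≠ 0 ∧ l ≠ q ^ 2

/-- The calculus belongs to the family `Γ̃_λ`. -/
def CalcName.IsTilde : CalcName → Prop
  | .tilde _ => True
  | _ => False

/-- The coefficients `(μ, ν)` of the invariant one-form `H₀ = μ H₊ + ν H₋` that generates the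
left module relations: `H₊ + λ H₋`, and `H₋` if `λ = ∞`. -/
def CalcName.relCoeff : CalcName → ℂ × ℂ
  | .tilde l => (1, l)
  | .prime l => (1, l)
  | .doublePrime l => (1, l)
  | .doublePrimeInfty => (0, 1)
  | .first l => (1, l)
  | .second l => (1, l)

/-- The coefficients `(μ, ν)` of the invariant one-form `H₁ = μ H₊ + ν H₋` that occurs in the
bimodule relations: `H₊`, except for `Γ̃''_0`, where `H₊ = 0` and `H₁ = H₋`. -/
def CalcName.auxCoeff : CalcName → ℂ × ℂ
  | .doublePrime l => open Classical in if l = 0 then (0, 1) else (1, 0)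
  | _ => (1, 0)

/-- Coefficients of a bimodule structure of the form
* `dz_k z_l = a₁ Rinv^{st}_{kl} z_s dz_t + b₁ z_k dz_l + c₁ z_k z_l H₁`
* `dz_k^* z_l^* = a₂ Rc^{st}_{kl} z_s^* dz_t^* + b₂ z_k^* dz_l^* + c₂ z_k^* z_l^* H₁`
* `dz_k z_l^* = a₃ Rlinv^{st}_{kl} z_s^* dz_t + b₃ z_k dz_l^* + c₃ z_k z_l^* H₁
    + d₃ q^{2k} δ_{kl} H₁`
* `dz_k^* z_l = a₄ Rr^{st}_{kl} z_s dz_t^* + b₄ z_k^* dz_l + c₄ z_k^* z_l H₁ + d₄ δ_{kl} H₁`. -/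
structure Coeffs where
  (a₁ b₁ c₁ : ℂ)
  (a₂ b₂ c₂ : ℂ)
  (a₃ b₃ c₃ d₃ : ℂ)
  (a₄ b₄ c₄ d₄ : ℂ)

/-- The coefficients of the bimodule structure of each calculus. -/
def CalcName.coeffs (N : ℕ) (q : ℂ) : CalcName → Coeffs
  | .tilde l =>
    { a₁ := q * l⁻¹, b₁ := q ^ 2 * l⁻¹ - 1, c₁ := q ^ 2 * l⁻¹ * (l⁻¹ - 1)
      a₂ := q⁻¹ * l, b₂ := (q ^ 2)⁻¹ * l - 1, c₂ := -(l - 1)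
      a₃ := q⁻¹ * l, b₃ := q ^ 2 * l⁻¹ - 1, c₃ := -(q ^ 2 * l⁻¹ - 1), d₃ := 0
      a₄ := q * l⁻¹, b₄ := (q ^ 2)⁻¹ * l - 1, c₄ := -(q ^ 2 * l⁻¹ - 1), d₄ := 0 }
  | .prime l =>
    { a₁ := q⁻¹, b₁ := 0, c₁ := -(l⁻¹ * (q ^ 4 * l⁻¹ - 1))
      a₂ := q, b₂ := 0, c₂ := -((q ^ 2)⁻¹ * l * (q ^ 4 * l⁻¹ - 1))
      a₃ := q, b₃ := 0, c₃ := q ^ 2 * l⁻¹ - 1, d₃ := 0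
      a₄ := q⁻¹, b₄ := 0, c₄ := q ^ 2 * l⁻¹ - 1, d₄ := 0 }
  | .doublePrime l => open Classical in
    if l = 0 then
      { a₁ := q⁻¹, b₁ := 0, c₁ := 0
        a₂ := q, b₂ := 0, c₂ := 0
        a₃ := q, b₃ := 0, c₃ := q ^ (2 * N + 2) * (s0 N q)⁻¹, d₃ := -(q ^ 2 * (s0 N q)⁻¹)
        a₄ := q⁻¹, b₄ := 0, c₄ := q ^ (2 * N + 2) * (s0 N q)⁻¹
        d₄ := -(q ^ (2 * N + 2) * (s0 N q)⁻¹) }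
    else
      { a₁ := q⁻¹, b₁ := 0, c₁ := 0
        a₂ := q, b₂ := 0, c₂ := 0
        a₃ := q, b₃ := 0, c₃ := -((s0 N q)⁻¹ * (q ^ (2 * N + 2) * l⁻¹ - 1))
        d₃ := (q ^ 2)⁻¹ * (s0 N q)⁻¹ * (q ^ 4 * l⁻¹ - 1)
        a₄ := q⁻¹, b₄ := 0, c₄ := -((s0 N q)⁻¹ * (q ^ (2 * N + 2) * l⁻¹ - 1))
        d₄ := q ^ (2 * N) * (q ^ 2)⁻¹ * (s0 N q)⁻¹ * (q ^ 4 * l⁻¹ - 1) }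
  | .doublePrimeInfty =>
    { a₁ := q⁻¹, b₁ := 0, c₁ := 0
      a₂ := q, b₂ := 0, c₂ := 0
      a₃ := q, b₃ := 0, c₃ := (s0 N q)⁻¹, d₃ := -((q ^ 2)⁻¹ * (s0 N q)⁻¹)
      a₄ := q⁻¹, b₄ := 0, c₄ := (s0 N q)⁻¹
      d₄ := -(q ^ (2 * N) * (q ^ 2)⁻¹ * (s0 N q)⁻¹) }
  | .first l =>
    { a₁ := q * l⁻¹, b₁ := q ^ 2 * l⁻¹ - 1, c₁ := q ^ 2 * l⁻¹ * (l⁻¹ - 1)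
      a₂ := q, b₂ := 0, c₂ := -((q ^ 2)⁻¹ * l * (q ^ 4 * l⁻¹ - 1))
      a₃ := q⁻¹ * l, b₃ := 0, c₃ := 0, d₃ := 0
      a₄ := q⁻¹, b₄ := (q ^ 2)⁻¹ * l - 1, c₄ := 0, d₄ := 0 }
  | .second l =>
    { a₁ := q⁻¹, b₁ := 0, c₁ := -(l⁻¹ * (q ^ 4 * l⁻¹ - 1))
      a₂ := q⁻¹ * l, b₂ := (q ^ 2)⁻¹ * l - 1, c₂ := -(l - 1)
      a₃ := q, b₃ := q ^ 2 * l⁻¹ - 1, c₃ := 0, d₃ := 0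
      a₄ := q * l⁻¹, b₄ := 0, c₄ := 0, d₄ := 0 }

/-! ### One-forms and relations on the sphere -/

namespace FODC

variable {N : ℕ} {q : ℂ} (C : FODC.{0, v} (Sphere N q))

/-- The invariant one-form `H₊ = ∑ z_i dz_i^*`. -/
def Hplus : C.Form := ∑ i : Fin N, (z i : Sphere N q) •> C.d (zs i)

/-- The invariant one-form `H₋ = ∑ q^{-2i} z_i^* dz_i`, the sum over `1 ≤ i ≤ N`. -/
def Hminus : C.Form :=
  ∑ i : Fin N, (q ^ (2 * ((i : ℕ) + 1)))⁻¹ • (zs i : Sphere N q) •> C.d (z i)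

/-- The combination `μ H₊ + ν H₋`. -/
def Hcomb (c : ℂ × ℂ) : C.Form := c.1 • C.Hplus + c.2 • C.Hminus

variable (κ : CalcName)

/-- The right-hand side of the relation for `dz_k z_l`. -/
def rhsZZ (k l : Fin N) : C.Form :=
  (κ.coeffs N q).a₁ • (∑ s : Fin N, ∑ t : Fin N,
      Rinv q s t k l • (z s : Sphere N q) •> C.d (z t))
    + (κ.coeffs N q).b₁ • (z k : Sphere N q) •> C.d (z l)
    + (κ.coeffs N q).c₁ • (z k * z l : Sphere N q) •> C.Hcomb κ.auxCoeff

/-- The right-hand side of the relation for `dz_k^* z_l^*`. -/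
def rhsSS (k l : Fin N) : C.Form :=
  (κ.coeffs N q).a₂ • (∑ s : Fin N, ∑ t : Fin N,
      Rc q s t k l • (zs s : Sphere N q) •> C.d (zs t))
    + (κ.coeffs N q).b₂ • (zs k : Sphere N q) •> C.d (zs l)
    + (κ.coeffs N q).c₂ • (zs k * zs l : Sphere N q) •> C.Hcomb κ.auxCoeff

/-- The right-hand side of the relation for `dz_k z_l^*`. -/
def rhsZS (k l : Fin N) : C.Form :=
  (κ.coeffs N q).a₃ • (∑ s : Fin N, ∑ t : Fin N,
      Rlinv q s t k l • (zs s : Sphere N q) •> C.d (z t))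
    + (κ.coeffs N q).b₃ • (z k : Sphere N q) •> C.d (zs l)
    + (κ.coeffs N q).c₃ • (z k * zs l : Sphere N q) •> C.Hcomb κ.auxCoeff
    + ((κ.coeffs N q).d₃ * q ^ (2 * ((k : ℕ) + 1)) * if k = l then 1 else 0) •
        C.Hcomb κ.auxCoeff

/-- The right-hand side of the relation for `dz_k^* z_l`. -/
def rhsSZ (k l : Fin N) : C.Form :=
  (κ.coeffs N q).a₄ • (∑ s : Fin N, ∑ t : Fin N,
      Rr q s t k l • (z s : Sphere N q) •> C.d (zs t))
    + (κ.coeffs N q).b₄ • (zs k : Sphere N q) •> C.d (z l)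
    + (κ.coeffs N q).c₄ • (zs k * z l : Sphere N q) •> C.Hcomb κ.auxCoeff
    + ((κ.coeffs N q).d₄ * if k = l then 1 else 0) • C.Hcomb κ.auxCoeff

/-- The one-forms that have to vanish in the calculus `κ`: the generating left module relation
`H₀` and the differences of both sides of the bimodule relations. -/
inductive DefiningForm : C.Form → Prop
  | rel : DefiningForm (C.Hcomb κ.relCoeff)
  | dzz (k l : Fin N) : DefiningForm (C.d (z k) <• (z l : Sphere N q) - C.rhsZZ κ k l)
  | dss (k l : Fin N) : DefiningForm (C.d (zs k) <• (zs l : Sphere N q) - C.rhsSS κ k l)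
  | dzs (k l : Fin N) : DefiningForm (C.d (z k) <• (zs l : Sphere N q) - C.rhsZS κ k l)
  | dsz (k l : Fin N) : DefiningForm (C.d (zs k) <• (z l : Sphere N q) - C.rhsSZ κ k l)

/-- `(Γ, d)` is a calculus of type `κ`: it has the bimodule structure belonging to `κ`, and the
relations between the one-forms `dz_i`, `dz_i^*` in the left module `Γ` are exactly the left
multiples of the one relation `H₀ = 0`. -/
structure IsCalculus : Prop where
  dzz : ∀ k l : Fin N, C.d (z k) <• (z l : Sphere N q) = C.rhsZZ κ k l
  dss : ∀ k l : Fin N, C.d (zs k) <• (zs l : Sphere N q) = C.rhsSS κ k l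
  dzs : ∀ k l : Fin N, C.d (z k) <• (zs l : Sphere N q) = C.rhsZS κ k l
  dsz : ∀ k l : Fin N, C.d (zs k) <• (z l : Sphere N q) = C.rhsSZ κ k l
  relations : ∀ x y : Fin N → Sphere N q,
    ∑ i, x i •> C.d (z i) + ∑ i, y i •> C.d (zs i) = 0 ↔
      ∃ p : Sphere N q, ∀ i,
        x i = (κ.relCoeff.2 * (q ^ (2 * ((i : ℕ) + 1)))⁻¹) • (p * zs i) ∧
        y i = κ.relCoeff.1 • (p * z i)

end FODC

/-- The calculus of type `κ` on the quantum sphere, given by generators and relations: the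
quotient of the universal first order differential calculus by the sub-bimodule generated by the
left module relation `H₀ = 0` and the bimodule relations. -/
def calculus (N : ℕ) (q : ℂ) (κ : CalcName) : FODC.{0, 0} (Sphere N q) :=
  (FODC.universal (Sphere N q)).quotient
    {ω | (FODC.universal (Sphere N q)).DefiningForm κ ω}

end QuantumSphere

end

noncomputable section

namespace QuantumSphere

open scoped TensorProduct RightActions

/-! ### Quotients of calculi -/

namespace FODC

section Quotient

variable {X : Type u} [Ring X] [Algebra ℂ X]

/-! Inner case: moving `x` through `H₊ = ∑ z_k dz_k^*` by the bimodule relations of `Γ̃_λ` gives `H₊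
x = x H₊ + (q⁻²λ - 1) dx` for every generator `x`. The R-matrix term becomes a multiple of `x H₊`,
because the R-matrix applied to products of coordinates is `q` times a reordering (`sum_R_z_mul_z`,
`sum_R_z_mul_zs`). The `b`-term becomes a multiple of `dx` by the sphere relation, and the `c`-term
corrects the coefficient of `x H₊` to 1. Commutators with a fixed form satisfy the Leibniz rule, so
the identity `dx = Hx - xH` spreads from generators to the whole algebra (`tilde_isInnerBy`).

Non-inner case: the obstruction is a functional `f` on one-forms with `f(xω) = χ(x) f(ω)` and `f(ωx)
= χ'(x) f(ω)` for two characters `χ`, `χ'`. If `dx = ωx - xω`, then `f(dx) = (χ'(x) - χ(x)) f(ω)`,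
so `f(dx)` must vanish wherever `χ(x) = χ'(x)`. The characters live on the circle of the first
coordinate, with `χ(z₁) = q` and `χ'(z₁) = 1`; both kill `z₂` and `z₂^*`. The functional takes the
values `α` on `dz₂`, `β` on `dz₂^*` and 0 on the other generators, and `(α, β) ≠ 0` contradicts
innerness. Such an `f` kills `H₊` and `H₋`, so compatibility with the bimodule relations only
constrains the `a` and `b` coefficients (`Coeffs.Compatible`), and outside `Γ̃_λ` a nonzero choice
exists.

The functional is built in two ways. For the generated calculus it comes from a twisted derivation
via the universal one-forms (`calculus_not_isInner`). For an arbitrary calculus of the type it is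
defined on left coordinates with respect to `dz_i`, `dz_i^*`, where the exact description of the
left relations makes it well defined (`IsCalculus.not_isInner`). -/

/-- The projection of a calculus onto its quotient. -/
def quotientMk (C : FODC.{u, v} X) (S : Set C.Form) : C.Form →ₗ[ℂ] (C.quotient S).Form :=
  letI := C.envModule
  { toFun := fun ω => (Submodule.Quotient.mk ω : C.Form ⧸ Submodule.span (Env X) S)
    map_add' := fun _ _ => rfl
    map_smul' := fun c ω => by
      change (Submodule.Quotient.mk (c • ω) : C.Form ⧸ Submodule.span (Env X) S) = algebraMap ℂ (Env X) c • Submodule.Quotient.mk ω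
      rw [← Submodule.Quotient.mk_smul, Algebra.TensorProduct.algebraMap_apply,
        TensorProduct.Algebra.smul_def, one_smul, algebraMap_smul] }

variable (C : FODC.{u, v} X) (S : Set C.Form)

theorem quotientMk_d (x : X) : C.quotientMk S (C.d x) = (C.quotient S).d x := rfl

theorem quotientMk_left (x : X) (ω : C.Form) :
    C.quotientMk S (x •> ω) = x •> C.quotientMk S ω := by
  let _ := C.envModule
  change (Submodule.Quotient.mk (x • ω) : C.Form ⧸ Submodule.span (Env X) S) =
    (x ⊗ₜ[ℂ] (1 : Xᵐᵒᵖ) : Env X) • Submodule.Quotient.mk ω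
  rw [← Submodule.Quotient.mk_smul, TensorProduct.Algebra.smul_def, one_smul]

theorem quotientMk_right (x : X) (ω : C.Form) :
    C.quotientMk S (ω <• x) = C.quotientMk S ω <• x := by
  let _ := C.envModule
  change (Submodule.Quotient.mk (ω <• x) : C.Form ⧸ Submodule.span (Env X) S) =
    ((1 : X) ⊗ₜ[ℂ] MulOpposite.op x : Env X) • Submodule.Quotient.mk ω
  rw [← Submodule.Quotient.mk_smul, TensorProduct.Algebra.smul_def, one_smul]

theorem quotientMk_surjective : Function.Surjective (C.quotientMk S) :=
  Quotient.mk_surjective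

theorem quotientMk_eq_zero {ω : C.Form} (h : ω ∈ S) : C.quotientMk S ω = 0 :=
  letI := C.envModule
  (Submodule.Quotient.mk_eq_zero (Submodule.span (Env X) S)).2 (Submodule.subset_span h)

/-- A functional that is multiplicative on both sides and vanishes on `S` vanishes on the kernel of
the projection. -/
theorem ker_quotientMk_le (f : C.Form →ₗ[ℂ] ℂ) (χ χ' : X → ℂ)
    (hl : ∀ x ω, f (x •> ω) = χ x * f ω) (hr : ∀ x ω, f (ω <• x) = χ' x * f ω)
    (hS : ∀ ω ∈ S, f ω = 0) : LinearMap.ker (C.quotientMk S) ≤ LinearMap.ker f := by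
  let _ := C.envModule
  intro ω hω
  have hω' : ω ∈ Submodule.span (Env X) S :=
    (Submodule.Quotient.mk_eq_zero (Submodule.span (Env X) S)).1 hω
  change f ω = 0
  clear hω
  induction hω' using Submodule.closure_induction with
  | zero => exact map_zero f
  | add a b _ _ ha hb => rw [map_add, ha, hb, add_zero]
  | smul_mem e s hs =>
    induction e using TensorProduct.induction_on with
    | zero => exact (congrArg f (zero_smul (Env X) s)).trans (map_zero f)
    | tmul a b =>
      rw [TensorProduct.Algebra.smul_def, hl]
      have := hr b.unop s
      rw [MulOpposite.op_unop] at this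
      rw [this, hS s hs, mul_zero, mul_zero]
    | add e e' he he' => rw [add_smul, map_add, he, he', add_zero]

theorem exists_functional_of_surjective {V W : Type*} [AddCommGroup V] [Module ℂ V]
    [AddCommGroup W] [Module ℂ W] (F : V →ₗ[ℂ] W) (hF : Function.Surjective F) (g : V →ₗ[ℂ] ℂ)
    (h : LinearMap.ker F ≤ LinearMap.ker g) : ∃ f : W →ₗ[ℂ] ℂ, ∀ x, f (F x) = g x := by
  refine ⟨(LinearMap.ker F).liftQ g h ∘ₗ (F.quotKerEquivOfSurjective hF).symm.toLinearMap,
    fun x => ?_⟩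
  have : (F.quotKerEquivOfSurjective hF).symm (F x) = Submodule.Quotient.mk x := by
    rw [LinearEquiv.symm_apply_eq]; rfl
  simp [this]

/-- A calculus with a functional that transforms under left and right multiplication by `χ` and
`χ'`, and does not vanish on some `dx` with `χ x = χ' x`, is not inner. -/
theorem not_isInner_of_functional (f : C.Form →ₗ[ℂ] ℂ) (χ χ' : X → ℂ)
    (hl : ∀ x ω, f (x •> ω) = χ x * f ω) (hr : ∀ x ω, f (ω <• x) = χ' x * f ω)
    (x : X) (hx : χ x = χ' x) (hd : f (C.d x) ≠ 0) : ¬ C.IsInner := by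
  rintro ⟨ω, hω⟩
  apply hd
  rw [hω x, map_sub, hl, hr, hx, sub_self]

/-- The argument stays upstairs: a candidate `ω` is lifted to `C`, where `dx = ωx - xω` holds up to
an element of the kernel of the projection, and `f` vanishes on that kernel. -/
theorem quotient_not_isInner_of_functional (f : C.Form →ₗ[ℂ] ℂ) (χ χ' : X → ℂ)
    (hl : ∀ x ω, f (x •> ω) = χ x * f ω) (hr : ∀ x ω, f (ω <• x) = χ' x * f ω)
    (hS : ∀ ω ∈ S, f ω = 0) (x : X) (hx : χ x = χ' x) (hd : f (C.d x) ≠ 0) :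
    ¬ (C.quotient S).IsInner := by
  rintro ⟨ω, hω⟩
  obtain ⟨ω, rfl⟩ := C.quotientMk_surjective S ω
  have h := hω x
  rw [← quotientMk_d, ← quotientMk_left, ← quotientMk_right, ← map_sub, ← sub_eq_zero,
    ← map_sub] at h
  have h' := C.ker_quotientMk_le S f χ χ' hl hr hS h
  rw [LinearMap.mem_ker, map_sub, map_sub, hl, hr, hx, sub_self, sub_zero] at h'
  exact hd h'

theorem d_one : C.d 1 = 0 := by
  have h := C.leibniz 1 1
  rw [mul_one, MulOpposite.op_one, one_smul, one_smul] at h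
  exact left_eq_add.1 h

theorem d_algebraMap (c : ℂ) : C.d (algebraMap ℂ X c) = 0 := by
  rw [Algebra.algebraMap_eq_smul_one, map_smul, d_one, smul_zero]

theorem smul_left (c : ℂ) (x : X) (ω : C.Form) : x •> (c • ω) = c • x •> ω := by
  rw [← algebraMap_smul X c ω, ← algebraMap_smul X c (x • ω), smul_smul, smul_smul,
    Algebra.commutes]

theorem smul_right (c : ℂ) (x : X) (ω : C.Form) : (c • ω) <• x = c • (ω <• x) := by
  rw [← algebraMap_smul Xᵐᵒᵖ c ω, ← algebraMap_smul Xᵐᵒᵖ c (MulOpposite.op x • ω), smul_smul,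
    smul_smul, Algebra.commutes]

theorem isInnerBy_mul {ω : C.Form} {x y : X} (hx : C.d x = ω <• x - x •> ω)
    (hy : C.d y = ω <• y - y •> ω) : C.d (x * y) = ω <• (x * y) - (x * y) •> ω := by
  rw [C.leibniz, hx, hy, smul_sub, smul_sub, MulOpposite.op_mul, mul_smul, mul_smul,
    smul_comm x (MulOpposite.op y) ω]
  abel

end Quotient

end FODC

/-! ### Relations and induction in the coordinate algebra -/

section Algebra

variable {N : ℕ} {q : ℂ}

theorem z_mul_z {i j : Fin N} (h : i < j) : (z i * z j : Sphere N q) = q • (z j * z i) := by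
  have := RingQuot.mkAlgHom_rel ℂ (SphereRel.zz (q := q) i j h)
  rwa [map_mul, map_smul, map_mul] at this

theorem z_mul_zs {i j : Fin N} (h : i ≠ j) : (z i * zs j : Sphere N q) = q • (zs j * z i) := by
  have := RingQuot.mkAlgHom_rel ℂ (SphereRel.zzs (q := q) i j h)
  rwa [map_mul, map_smul, map_mul] at this

theorem zs_mul_z (i : Fin N) : (zs i * z i : Sphere N q) =
    z i * zs i + (q⁻¹ * bigQ q) • ∑ k ∈ Finset.Ioi i, z k * zs k := by
  have := RingQuot.mkAlgHom_rel ℂ (SphereRel.diag (q := q) i)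
  simp only [map_mul, map_smul, map_add, map_sub, map_sum, map_zero] at this
  change z i * zs i - zs i * z i + (q⁻¹ * bigQ q) • ∑ k ∈ Finset.Ioi i, z k * zs k = 0 at this
  rw [sub_add_eq_add_sub, sub_eq_zero] at this
  exact this.symm

theorem sum_z_mul_zs : (∑ i, z i * zs i : Sphere N q) = 1 := by
  have := RingQuot.mkAlgHom_rel ℂ (SphereRel.sphere (N := N) (q := q))
  rw [map_sum, map_one] at this
  simp only [map_mul] at this
  exact this

theorem sphere_induction {P : Sphere N q → Prop} (scalar : ∀ c : ℂ, P (algebraMap ℂ _ c))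
    (hz : ∀ i, P (z i)) (hzs : ∀ i, P (zs i)) (add : ∀ x y, P x → P y → P (x + y))
    (mul : ∀ x y, P x → P y → P (x * y)) (x : Sphere N q) : P x := by
  obtain ⟨a, rfl⟩ := RingQuot.mkAlgHom_surjective ℂ (SphereRel N q) x
  induction a using FreeAlgebra.induction with
  | grade0 c => simpa only [AlgHom.commutes] using scalar c
  | grade1 g =>
    cases g with
    | z i => exact hz i
    | zs i => exact hzs i
  | mul a b ha hb => rw [map_mul]; exact mul _ _ ha hb
  | add a b ha hb => rw [map_add]; exact add _ _ ha hb

/-- The algebra map given by images of the generators that satisfy the relations. -/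
theorem exists_algHom {A : Type*} [Ring A] [Algebra ℂ A] (a b : Fin N → A)
    (hzz : ∀ i j, i < j → a i * a j = q • (a j * a i))
    (hss : ∀ i j, i < j → b i * b j = q⁻¹ • (b j * b i))
    (hzs : ∀ i j, i ≠ j → a i * b j = q • (b j * a i))
    (hd : ∀ i, a i * b i - b i * a i + (q⁻¹ * bigQ q) • ∑ k ∈ Finset.Ioi i, a k * b k = 0)
    (h1 : ∑ i, a i * b i = 1) :
    ∃ φ : Sphere N q →ₐ[ℂ] A, (∀ i, φ (z i) = a i) ∧ ∀ i, φ (zs i) = b i := by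
  let g : Gen N → A := fun x => match x with
    | .z i => a i
    | .zs i => b i
  refine ⟨RingQuot.liftAlgHom ℂ ⟨FreeAlgebra.lift ℂ g, fun x y h => ?_⟩, fun i => ?_, fun i => ?_⟩
  · cases h with
    | zz i j h => simpa [g] using hzz i j h
    | zszs i j h => simpa [g] using hss i j h
    | zzs i j h => simpa [g] using hzs i j h
    | diag i => simpa [g] using hd i
    | sphere => simpa [g] using h1
  · rw [z, RingQuot.liftAlgHom_mkAlgHom_apply, FreeAlgebra.lift_ι_apply]
  · rw [zs, RingQuot.liftAlgHom_mkAlgHom_apply, FreeAlgebra.lift_ι_apply]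

/-- A form in nested Kronecker deltas, which lets `simp` collapse double sums. The diagonal value
`q` is absorbed into the flip term. -/
theorem R_eq_add (q : ℂ) (i j k l : Fin N) : R q i j k l =
    (if i = l then if j = k then if k = l then q else 1 else 0 else 0) +
      (if i = k then if j = l then if i < j then bigQ q else 0 else 0 else 0) := by
  unfold R
  grind

/-- `∑ R^{ks}_{lt} z_k z_s = q z_l z_t`. -/
theorem sum_R_z_mul_z (hq : q ≠ 0) (l t : Fin N) :
    (∑ k, ∑ s, R q k s l t • (z k * z s) : Sphere N q) = q • (z l * z t) := by
  have h : (∑ k, ∑ s, R q k s l t • (z k * z s) : Sphere N q) =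
      (if l = t then q else 1) • (z t * z l) + (if l < t then bigQ q else 0) • (z l * z t) := by
    simp [R_eq_add, add_smul, Finset.sum_add_distrib, ite_smul]
  rw [h]
  rcases lt_trichotomy l t with h | rfl | h
  -- Both terms are multiples of `z_t z_l`, and the coefficients agree because `1 + Qq = q²`.
  · rw [if_neg h.ne, if_pos h, z_mul_z h, one_smul, smul_smul, smul_smul, ← one_smul ℂ (z t * z l),
      smul_smul, smul_smul, ← add_smul]
    congr 1
    unfold bigQ
    field_simp
    ring
  · simp
  · rw [if_neg h.ne', if_neg h.not_gt, z_mul_z h, one_smul, zero_smul, add_zero]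

/-- `∑ R^{lk}_{ts} z_k z_s^* = q z_l^* z_t`. -/
theorem sum_R_z_mul_zs (hq : q ≠ 0) (l t : Fin N) :
    (∑ k, ∑ s, R q l k t s • (z k * zs s) : Sphere N q) = q • (zs l * z t) := by
  have h : (∑ k, ∑ s, R q l k t s • (z k * zs s) : Sphere N q) =
      (if l = t then q else 1) • (z t * zs l) +
        if l = t then bigQ q • ∑ k ∈ Finset.Ioi l, z k * zs k else 0 := by
    simp only [R_eq_add, add_smul, Finset.sum_add_distrib]
    congr 1
    · simp [ite_smul, eq_comm]
    · by_cases h : l = t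
      · simp [h, ite_smul, ← Finset.sum_filter, Finset.smul_sum]
        congr 1
        ext; simp
      · simp [h]
  rw [h]
  by_cases h : l = t
  · subst h
    -- On the diagonal the `Q`-sum over `k > l` is exactly the defect in the commutation of `z_l`
    -- and `z_l^*`.
    rw [if_pos rfl, if_pos rfl, zs_mul_z, smul_add, smul_smul, mul_inv_cancel_left₀ hq]
  · rw [if_neg h, if_neg h, add_zero, one_smul, z_mul_zs (Ne.symm h)]

end Algebra
/-! ### The family of inner calculi -/

namespace FODC

variable {N : ℕ} {q : ℂ} (C : FODC.{0, v} (Sphere N q))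

theorem Hcomb_auxCoeff_tilde (l : ℂ) : C.Hcomb (CalcName.tilde l).auxCoeff = C.Hplus := by
  simp [Hcomb, CalcName.auxCoeff]

theorem Hplus_right (x : Sphere N q) :
    C.Hplus <• x = ∑ k : Fin N, (z k : Sphere N q) •> (C.d (zs k) <• x) := by
  rw [Hplus, Finset.smul_sum]
  exact Finset.sum_congr rfl fun k _ => (smul_comm _ _ _).symm

/-- Regrouping by the differential `ω t` isolates the contraction of the matrix with two
coordinates, which the R-matrix identities evaluate. -/
theorem sum_left_sum (c : Fin N → Fin N → Fin N → ℂ) (x y : Fin N → Sphere N q)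
    (ω : Fin N → C.Form) :
    ∑ k, x k •> ∑ s, ∑ t, c k s t • y s •> ω t =
      ∑ t, (∑ k, ∑ s, c k s t • (x k * y s)) •> ω t := by
  simp only [Finset.smul_sum, Finset.sum_smul, smul_left, smul_assoc, mul_smul]
  exact (Finset.sum_congr rfl fun k _ => Finset.sum_comm).trans Finset.sum_comm

theorem sum_left_Hplus (x : Sphere N q) : ∑ t, (q • (x * z t)) •> C.d (zs t) =
    q • x •> C.Hplus := by
  simp only [Hplus, Finset.smul_sum, smul_assoc, mul_smul]

theorem sum_z_zs_left (ω : C.Form) :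
    ∑ k : Fin N, (z k : Sphere N q) •> (zs k : Sphere N q) •> ω = ω := by
  simp_rw [smul_smul, ← Finset.sum_smul]
  rw [sum_z_mul_zs, one_smul]

theorem tilde_Hplus_z (hq : q ≠ 0) {l : ℂ} (hsz : ∀ k j : Fin N,
    C.d (zs k) <• (z j : Sphere N q) = C.rhsSZ (.tilde l) k j) (j : Fin N) :
    C.Hplus <• (z j : Sphere N q) =
      (z j : Sphere N q) •> C.Hplus + ((q ^ 2)⁻¹ * l - 1) • C.d (z j) := by
  simp only [Hplus_right, hsz, rhsSZ, Hcomb_auxCoeff_tilde, CalcName.coeffs, zero_mul, zero_smul,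
    add_zero, smul_add, smul_left, Finset.sum_add_distrib, ← Finset.smul_sum, sum_left_sum, Rr,
    sum_R_z_mul_z hq, sum_left_Hplus, mul_smul, sum_z_zs_left]
  rw [add_right_comm, smul_smul, smul_smul, ← add_smul]
  congr 1
  -- The R-matrix term and the `c₄`-term together contribute `z_j H₊` with coefficient 1.
  rw [show q * l⁻¹ * q + -(q ^ 2 * l⁻¹ - 1) = 1 by ring, one_smul]

theorem tilde_Hplus_zs (hq : q ≠ 0) {l : ℂ} (hss : ∀ k j : Fin N,
    C.d (zs k) <• (zs j : Sphere N q) = C.rhsSS (.tilde l) k j) (j : Fin N) :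
    C.Hplus <• (zs j : Sphere N q) =
      (zs j : Sphere N q) •> C.Hplus + ((q ^ 2)⁻¹ * l - 1) • C.d (zs j) := by
  simp only [Hplus_right, hss, rhsSS, Hcomb_auxCoeff_tilde, CalcName.coeffs,
    smul_add, smul_left, Finset.sum_add_distrib, ← Finset.smul_sum, sum_left_sum, Rc,
    sum_R_z_mul_zs hq, sum_left_Hplus, mul_smul, sum_z_zs_left]
  rw [add_right_comm, smul_smul, smul_smul, ← add_smul]
  congr 1
  rw [show q⁻¹ * l * q + -(l - 1) = 1 by field_simp; ring, one_smul]

/-- Since `H₊` contains only the differentials `dz_k^*`, the two relations for `dz_k^*` suffice.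
Taking just these as hypotheses covers the generated calculus and every calculus of the type at
once. -/
theorem tilde_isInnerBy (hq : q ≠ 0) {l : ℂ} (hl : (CalcName.tilde l).Admissible q)
    (hsz : ∀ k j : Fin N, C.d (zs k) <• (z j : Sphere N q) = C.rhsSZ (.tilde l) k j)
    (hss : ∀ k j : Fin N, C.d (zs k) <• (zs j : Sphere N q) = C.rhsSS (.tilde l) k j) :
    C.IsInnerBy (((q ^ 2)⁻¹ * l - 1)⁻¹ • C.Hplus) := by
  -- This is where the excluded value `λ = q²` matters.
  have hc : (q ^ 2)⁻¹ * l - 1 ≠ 0 := by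
    intro h
    apply hl.2
    have := sub_eq_zero.1 h
    field_simp at this
    exact this
  have key : ∀ x : Sphere N q,
      C.Hplus <• x = x •> C.Hplus + ((q ^ 2)⁻¹ * l - 1) • C.d x →
      C.d x = (((q ^ 2)⁻¹ * l - 1)⁻¹ • C.Hplus) <• x - x •> (((q ^ 2)⁻¹ * l - 1)⁻¹ • C.Hplus) := by
    intro x hx
    rw [smul_left, smul_right, hx, smul_add, add_sub_cancel_left, smul_smul, inv_mul_cancel₀ hc,
      one_smul]
  intro x
  induction x using sphere_induction with
  | scalar c =>
    apply key
    rw [d_algebraMap, smul_zero, add_zero, algebraMap_smul]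
    exact algebraMap_smul (Sphere N q)ᵐᵒᵖ c C.Hplus
  | hz i => exact key _ (C.tilde_Hplus_z hq hsz i)
  | hzs i => exact key _ (C.tilde_Hplus_zs hq hss i)
  | add x y hx hy => rw [map_add, hx, hy, MulOpposite.op_add, add_smul, add_smul]; abel
  | mul x y hx hy => exact C.isInnerBy_mul hx hy

/-! ### Defining relations in the quotient -/

section Quotient

variable (S : Set C.Form)

theorem quotientMk_Hplus : C.quotientMk S C.Hplus = (C.quotient S).Hplus := by
  simp only [Hplus, map_sum, quotientMk_left, quotientMk_d]

theorem quotientMk_Hminus : C.quotientMk S C.Hminus = (C.quotient S).Hminus := by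
  simp only [Hminus, map_sum, map_smul, quotientMk_left, quotientMk_d]

theorem quotientMk_rhsSS (κ : CalcName) (k l : Fin N) :
    C.quotientMk S (C.rhsSS κ k l) = (C.quotient S).rhsSS κ k l := by
  simp only [rhsSS, Hcomb, map_add, map_sum, map_smul, quotientMk_left, quotientMk_d,
    quotientMk_Hplus, quotientMk_Hminus]

theorem quotientMk_rhsSZ (κ : CalcName) (k l : Fin N) :
    C.quotientMk S (C.rhsSZ κ k l) = (C.quotient S).rhsSZ κ k l := by
  simp only [rhsSZ, Hcomb, map_add, map_sum, map_smul, quotientMk_left, quotientMk_d,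
    quotientMk_Hplus, quotientMk_Hminus]

end Quotient

end FODC

theorem calculus_dss (N : ℕ) (q : ℂ) (κ : CalcName) (k l : Fin N) :
    (calculus N q κ).d (zs k) <• (zs l : Sphere N q) = (calculus N q κ).rhsSS κ k l := by
  have h := FODC.quotientMk_eq_zero _ {ω | (FODC.universal (Sphere N q)).DefiningForm κ ω}
    (FODC.DefiningForm.dss k l)
  rwa [map_sub, FODC.quotientMk_right, FODC.quotientMk_rhsSS, sub_eq_zero] at h

theorem calculus_dsz (N : ℕ) (q : ℂ) (κ : CalcName) (k l : Fin N) :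
    (calculus N q κ).d (zs k) <• (z l : Sphere N q) = (calculus N q κ).rhsSZ κ k l := by
  have h := FODC.quotientMk_eq_zero _ {ω | (FODC.universal (Sphere N q)).DefiningForm κ ω}
    (FODC.DefiningForm.dsz k l)
  rwa [map_sub, FODC.quotientMk_right, FODC.quotientMk_rhsSZ, sub_eq_zero] at h
/-! ### Twisted derivations and functionals on one-forms -/

namespace FODC

/-- A derivation `δ` twisted by two characters extends to the universal one-forms. -/
theorem exists_functional_universal {X : Type u} [Ring X] [Algebra ℂ X] (χ χ' : X →ₐ[ℂ] ℂ)
    (δ : X →ₗ[ℂ] ℂ) (hδ : ∀ x y, δ (x * y) = χ x * δ y + δ x * χ' y) :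
    ∃ f : (universal X).Form →ₗ[ℂ] ℂ, (∀ x ω, f (x •> ω) = χ x * f ω) ∧
      (∀ x ω, f (ω <• x) = χ' x * f ω) ∧ ∀ x, f ((universal X).d x) = δ x := by
  -- `Φ(a ⊗ b) = χ(a) δ(b)`, and `θ(a ⊗ b) = χ(a) χ'(b)` below is the character of the enveloping
  -- algebra by which it should transform. This holds on the universal forms: `(a ⊗ b) dx` is sent
  -- to `χ(a) (δ(xb) - χ(x) δ(b)) = χ(a) δ(x) χ'(b)`.
  let Φ : Env X →ₗ[ℂ] ℂ := LinearMap.mul' ℂ ℂ ∘ₗ TensorProduct.map χ.toLinearMap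
    (δ ∘ₗ (MulOpposite.opLinearEquiv ℂ).symm.toLinearMap)
  have hΦ : ∀ a b, Φ (a ⊗ₜ b) = χ a * δ b.unop := fun a b => rfl
  let θ : Env X →ₗ[ℂ] ℂ := LinearMap.mul' ℂ ℂ ∘ₗ TensorProduct.map χ.toLinearMap
    (χ'.toLinearMap ∘ₗ (MulOpposite.opLinearEquiv ℂ).symm.toLinearMap)
  have hθ : ∀ a b, θ (a ⊗ₜ b) = χ a * χ' b.unop := fun a b => rfl
  have h1 : ∀ (e : Env X) (x : X), Φ (e * (universalD X x : Env X)) = θ e * δ x := by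
    intro e x
    induction e using TensorProduct.induction_on with
    | zero => simp
    | tmul a b =>
      change Φ (a ⊗ₜ b * ((1 : X) ⊗ₜ[ℂ] MulOpposite.op x - x ⊗ₜ[ℂ] (1 : Xᵐᵒᵖ))) = _
      rw [mul_sub, Algebra.TensorProduct.tmul_mul_tmul, Algebra.TensorProduct.tmul_mul_tmul,
        map_sub, hΦ, hΦ, hθ]
      simp only [MulOpposite.unop_mul, MulOpposite.unop_op, mul_one, hδ, map_mul]
      ring
    | add e e' he he' => rw [add_mul, map_add, he, he', map_add, add_mul]
  have hθm : ∀ e e', θ (e * e') = θ e * θ e' := by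
    intro e e'
    induction e using TensorProduct.induction_on with
    | zero => simp
    | tmul a b =>
      induction e' using TensorProduct.induction_on with
      | zero => simp
      | tmul c d =>
        rw [Algebra.TensorProduct.tmul_mul_tmul, hθ, hθ, hθ, MulOpposite.unop_mul, map_mul,
          map_mul]
        ring
      | add c d hc hd => rw [mul_add, map_add, hc, hd, map_add, mul_add]
    | add c d hc hd => rw [add_mul, map_add, hc, hd, map_add, add_mul]
  have h2 : ∀ (e : Env X) (ω : universalForms X), Φ (e * (ω : Env X)) = θ e * Φ ω := by
    rintro e ⟨ω, hω⟩
    change Φ (e * ω) = θ e * Φ ω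
    induction hω using Submodule.closure_induction with
    | zero => simp
    | add a b _ _ ha hb => rw [mul_add, map_add, ha, hb, map_add, mul_add]
    | smul_mem r y hy =>
      obtain ⟨x, rfl⟩ := hy
      have := h1 (e * r) x
      rw [mul_assoc, hθm, mul_assoc, ← h1 r x] at this
      exact this
  refine ⟨{ toFun := fun ω : universalForms X => Φ ω, map_add' := fun a b => map_add Φ _ _,
            map_smul' := fun c ω => ?_ }, fun x ω => ?_, fun x ω => ?_, fun x => ?_⟩
  · refine (h2 (algebraMap ℂ (Env X) c) ω).trans ?_
    rw [Algebra.TensorProduct.algebraMap_apply, hθ, AlgHom.commutes, MulOpposite.unop_one, map_one,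
      mul_one]
    rfl
  · have := h2 (x ⊗ₜ 1) ω
    rw [hθ, MulOpposite.unop_one, map_one, mul_one] at this
    exact this
  · have := h2 (1 ⊗ₜ MulOpposite.op x) ω
    rw [hθ, MulOpposite.unop_op, map_one, one_mul] at this
    exact this
  · have := h1 1 x
    rw [one_mul, Algebra.TensorProduct.one_def, hθ, MulOpposite.unop_one, map_one, map_one,
      one_mul, one_mul] at this
    exact this

end FODC

/-- Two characters of the coordinate algebra and a derivation that is twisted by them. -/
theorem exists_twisted_derivation (n : ℕ) {q : ℂ} (hq : q ≠ 0) (α β : ℂ) :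
    ∃ (χ χ' : Sphere (n + 2) q →ₐ[ℂ] ℂ) (δ : Sphere (n + 2) q →ₗ[ℂ] ℂ),
      (∀ x y, δ (x * y) = χ x * δ y + δ x * χ' y) ∧
      (∀ i, χ (z i) = if i = 0 then q else 0) ∧ (∀ i, χ (zs i) = if i = 0 then q⁻¹ else 0) ∧
      (∀ i, χ' (z i) = if i = 0 then 1 else 0) ∧ (∀ i, χ' (zs i) = if i = 0 then 1 else 0) ∧
      (∀ i, δ (z i) = if i = 1 then α else 0) ∧ ∀ i, δ (zs i) = if i = 1 then β else 0 := by
  have character : ∀ u : ℂ, u ≠ 0 → ∃ χ : Sphere (n + 2) q →ₐ[ℂ] ℂ,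
      (∀ i, χ (z i) = if i = 0 then u else 0) ∧ ∀ i, χ (zs i) = if i = 0 then u⁻¹ else 0 := by
    intro u hu
    refine exists_algHom _ _ ?_ ?_ ?_ ?_ ?_
    · intro i j h
      simp [(Fin.zero_le i).trans_lt h |>.ne']
    · intro i j h
      simp [(Fin.zero_le i).trans_lt h |>.ne']
    · intro i j h
      by_cases hi : i = 0
      · simp [hi, (hi ▸ h : 0 ≠ j).symm]
      · simp [hi]
    · intro i
      rw [mul_comm, sub_self, zero_add, Finset.sum_eq_zero, smul_zero]
      intro k hk
      simp [((Fin.zero_le i).trans_lt (Finset.mem_Ioi.1 hk)).ne']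
    · simp [hu]
  obtain ⟨χ, hz, hs⟩ := character q hq
  obtain ⟨χ', hz', hs'⟩ := character 1 one_ne_zero
  rw [inv_one] at hs'
  -- A twisted derivation is the same as an upper triangular representation with diagonal `(χ, χ')`
  -- and corner `δ`. The ratio `χ(z₁)/χ'(z₁) = q` matches the factor `q` in `z₁z₂ = q z₂z₁` and
  -- `z₁z₂^* = q z₂^*z₁`, so the corner entries `α`, `β` are free. Index 0 is the first coordinate,
  -- index 1 the second.
  let a : Fin (n + 2) → Matrix (Fin 2) (Fin 2) ℂ := fun i =>
    !![if i = 0 then q else 0, if i = 1 then α else 0; 0, if i = 0 then 1 else 0]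
  let b : Fin (n + 2) → Matrix (Fin 2) (Fin 2) ℂ := fun i =>
    !![if i = 0 then q⁻¹ else 0, if i = 1 then β else 0; 0, if i = 0 then 1 else 0]
  have ha : ∀ i, a i 0 0 = (if i = 0 then q else 0) ∧ a i 0 1 = (if i = 1 then α else 0) ∧
      a i 1 0 = 0 ∧ a i 1 1 = if i = 0 then 1 else 0 := fun i => ⟨rfl, rfl, rfl, rfl⟩
  have hb : ∀ i, b i 0 0 = (if i = 0 then q⁻¹ else 0) ∧ b i 0 1 = (if i = 1 then β else 0) ∧
      b i 1 0 = 0 ∧ b i 1 1 = if i = 0 then 1 else 0 := fun i => ⟨rfl, rfl, rfl, rfl⟩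
  have hab : ∀ i, a i * b i = if i = 0 then 1 else 0 := by
    intro i
    by_cases hi : i = 0
    · subst hi; simp [a, b, hq, Matrix.one_fin_two]
    · ext r s
      fin_cases r <;> fin_cases s <;> simp [Matrix.mul_apply, ha, hb, hi]
  have hba : ∀ i, b i * a i = if i = 0 then 1 else 0 := by
    intro i
    by_cases hi : i = 0
    · subst hi; simp [a, b, hq, Matrix.one_fin_two]
    · ext r s
      fin_cases r <;> fin_cases s <;> simp [Matrix.mul_apply, ha, hb, hi]
  obtain ⟨ρ, hρz, hρs⟩ := exists_algHom (q := q) a b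
    (by
      intro i j h
      have hj := ((Fin.zero_le i).trans_lt h).ne'
      ext r s
      by_cases hi : i = 0 <;> fin_cases r <;> fin_cases s <;> simp [Matrix.mul_apply, ha, hj, hi])
    (by
      intro i j h
      have hj := ((Fin.zero_le i).trans_lt h).ne'
      ext r s
      by_cases hi : i = 0 <;> fin_cases r <;> fin_cases s <;> simp [Matrix.mul_apply, hb, hj, hi])
    (by
      intro i j h
      ext r s
      by_cases hi : i = 0
      · have hj : j ≠ 0 := (hi ▸ h).symm
        fin_cases r <;> fin_cases s <;> simp [Matrix.mul_apply, ha, hb, hj, hi]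
      · by_cases hj : j = 0 <;> fin_cases r <;> fin_cases s <;> simp [Matrix.mul_apply, ha, hb, hi, hj, hq])
    (by
      intro i
      rw [hab, hba, sub_self, zero_add, Finset.sum_eq_zero, smul_zero]
      intro k hk
      rw [hab, if_neg ((Fin.zero_le i).trans_lt (Finset.mem_Ioi.1 hk)).ne'])
    (by simp [hab])
  have hρ : ∀ x, ρ x 0 0 = χ x ∧ ρ x 1 0 = 0 ∧ ρ x 1 1 = χ' x := by
    intro x
    induction x using sphere_induction with
    | scalar c => simp [AlgHom.commutes, Matrix.algebraMap_matrix_apply]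
    | hz i => simp [hρz, a, hz, hz']
    | hzs i => simp [hρs, b, hs, hs']
    | add x y hx hy => simp [hx, hy]
    | mul x y hx hy => simp [Matrix.mul_apply, hx, hy]
  refine ⟨χ, χ', { toFun := fun x => ρ x 0 1, map_add' := by simp, map_smul' := by simp },
    fun x y => ?_, hz, hs, hz', hs', fun i => ?_, fun i => ?_⟩
  · change ρ (x * y) 0 1 = χ x * ρ y 0 1 + ρ x 0 1 * χ' y
    rw [map_mul, Matrix.mul_apply, Fin.sum_univ_two, (hρ x).1, (hρ y).2.2]
  · change ρ (z i) 0 1 = _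
    rw [hρz]; rfl
  · change ρ (zs i) 0 1 = _
    rw [hρs]; rfl

/-- The conditions on the bimodule structure under which the values `α` on `dz₂` and `β` on `dz₂^*`
define a functional on one-forms that is multiplicative on both sides. -/
structure Coeffs.Compatible (q : ℂ) (c : Coeffs) (α β : ℂ) : Prop where
  a₁ : α * (c.a₁ * q) = α
  b₁ : α * c.b₁ = 0
  a₂ : β * (c.a₂ * q⁻¹) = β
  b₂ : β * c.b₂ = 0
  a₃ : α * (c.a₃ * q⁻¹) = α
  b₃ : β * c.b₃ = 0
  a₄ : β * (c.a₄ * q) = β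
  b₄ : α * c.b₄ = 0

/-- For `Γ̃'`, `Γ̃''` and `Γ̃⁽²⁾` one has `a₁ = q⁻¹`, `a₃ = q` and `b₁ = b₄ = 0`, which allows `α =
1`, `β = 0`. For `Γ̃⁽¹⁾` the conditions on `β` hold instead: `a₂ = q`, `a₄ = q⁻¹` and `b₂ = b₃ = 0`.
-/
theorem CalcName.exists_compatible (N : ℕ) {q : ℂ} (hq : q ≠ 0) (κ : CalcName)
    (hκ : ¬ κ.IsTilde) : ∃ α β : ℂ, (α ≠ 0 ∨ β ≠ 0) ∧ (κ.coeffs N q).Compatible q α β := by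
  cases κ with
  | tilde l => exact absurd trivial hκ
  | prime l => exact ⟨1, 0, by simp, by constructor <;> simp [coeffs, hq]⟩
  | doublePrime l =>
    refine ⟨1, 0, by simp, ?_⟩
    by_cases hl : l = 0 <;> constructor <;> simp [coeffs, hq, hl]
  | doublePrimeInfty => exact ⟨1, 0, by simp, by constructor <;> simp [coeffs, hq]⟩
  | first l => exact ⟨0, 1, by simp, by constructor <;> simp [coeffs, hq]⟩
  | second l => exact ⟨1, 0, by simp, by constructor <;> simp [coeffs, hq]⟩

namespace FODC

/-! ### Values of a twisted functional on the right-hand sides of the bimodule relations -/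

section Functional

variable {n : ℕ} {q : ℂ} (C : FODC.{0, v} (Sphere (n + 2) q))

/-- A functional on one-forms that is multiplicative from the left with respect to the character
`z₁ ↦ q`, and is `α` on `dz₂`, `β` on `dz₂^*`, and zero on the other differentials of generators. -/
structure IsTwisted (f : C.Form →ₗ[ℂ] ℂ) (χ : Sphere (n + 2) q →ₐ[ℂ] ℂ) (α β : ℂ) : Prop where
  left : ∀ x ω, f (x •> ω) = χ x * f ω
  χ_z : ∀ i, χ (z i) = if i = 0 then q else 0
  χ_zs : ∀ i, χ (zs i) = if i = 0 then q⁻¹ else 0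
  d_z : ∀ i, f (C.d (z i)) = if i = 1 then α else 0
  d_zs : ∀ i, f (C.d (zs i)) = if i = 1 then β else 0

variable {C} {f : C.Form →ₗ[ℂ] ℂ} {χ : Sphere (n + 2) q →ₐ[ℂ] ℂ} {α β : ℂ}
  (hf : C.IsTwisted f χ α β) {κ : CalcName}
include hf

/-- The character sees only the first coordinate and the differentials only the second, while `H₊`
and `H₋` pair equal indices. Hence the `c` and `d` coefficients play no role below. -/
theorem IsTwisted.Hcomb (c : ℂ × ℂ) : f (C.Hcomb c) = 0 := by
  simp [FODC.Hcomb, Hplus, Hminus, hf.left, hf.χ_z, hf.χ_zs, hf.d_z, hf.d_zs]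

/-- The value is `χ'(z_l) f(dz_k)`, as right multiplicativity demands. Only the matrix entry with
upper indices `(0, 1)` survives; it is a pure flip, since the `Q`-entries have the opposite index
order. The `b₁`-term can contribute only for `k = 0`, `l = 1`. The three lemmas that follow work the
same way. -/
theorem IsTwisted.rhsZZ (h : (κ.coeffs (n + 2) q).Compatible q α β) (k l : Fin (n + 2)) :
    f (C.rhsZZ κ k l) = (if l = 0 then 1 else 0) * if k = 1 then α else 0 := by
  have hR : Rinv q 0 1 k l = if k = 1 ∧ l = 0 then 1 else 0 := by
    have := Fin.zero_ne_one (n := n)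
    unfold Rinv; grind
  have h1 := h.a₁
  have h2 := h.b₁
  simp only [FODC.rhsZZ, map_add, map_smul, map_sum, hf.left, hf.χ_z, hf.d_z, hf.Hcomb]
  simp [hR]
  grind

theorem IsTwisted.rhsSS (h : (κ.coeffs (n + 2) q).Compatible q α β) (k l : Fin (n + 2)) :
    f (C.rhsSS κ k l) = (if l = 0 then 1 else 0) * if k = 1 then β else 0 := by
  have hR : Rc q 0 1 k l = if k = 1 ∧ l = 0 then 1 else 0 := by
    have := Fin.zero_ne_one (n := n)
    unfold Rc R; grind
  have h1 := h.a₂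
  have h2 := h.b₂
  simp only [FODC.rhsSS, map_add, map_smul, map_sum, hf.left, hf.χ_zs, hf.d_zs, hf.Hcomb]
  simp [hR]
  grind

theorem IsTwisted.rhsZS (h : (κ.coeffs (n + 2) q).Compatible q α β) (k l : Fin (n + 2)) :
    f (C.rhsZS κ k l) = (if l = 0 then 1 else 0) * if k = 1 then α else 0 := by
  have hR : Rlinv q 0 1 k l = if k = 1 ∧ l = 0 then 1 else 0 := by
    have : Rinv q 1 l 0 k = if k = 1 ∧ l = 0 then 1 else 0 := by
      have := Fin.zero_ne_one (n := n)
      unfold Rinv; grind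
    rw [Rlinv, this]
    -- The power of `q` is trivial at the only nonzero entry, where `l = 0`.
    by_cases hl : l = 0 <;> simp [hl]
  have h1 := h.a₃
  have h2 := h.b₃
  simp only [FODC.rhsZS, map_add, map_smul, map_sum, hf.left, hf.χ_z, hf.χ_zs, hf.d_z, hf.d_zs,
    hf.Hcomb]
  simp [hR]
  grind

theorem IsTwisted.rhsSZ (h : (κ.coeffs (n + 2) q).Compatible q α β) (k l : Fin (n + 2)) :
    f (C.rhsSZ κ k l) = (if l = 0 then 1 else 0) * if k = 1 then β else 0 := by
  have hR : Rr q 0 1 k l = if k = 1 ∧ l = 0 then 1 else 0 := by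
    have := Fin.zero_ne_one (n := n)
    unfold Rr R; grind
  have h1 := h.a₄
  have h2 := h.b₄
  simp only [FODC.rhsSZ, map_add, map_smul, map_sum, hf.left, hf.χ_z, hf.χ_zs, hf.d_z, hf.d_zs,
    hf.Hcomb]
  simp [hR]
  grind

end Functional

end FODC
/-! ### Calculi that are not inner -/

namespace FODC

/-! ### Left coordinates with respect to the differentials of the generators -/

section LeftCoordinates

variable {N : ℕ} {q : ℂ} (C : FODC.{0, v} (Sphere N q))

/-- The left linear map `(x, y) ↦ ∑ x_i dz_i + ∑ y_i dz_i^*`. -/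
def ofCoordinates : ((Fin N → Sphere N q) × (Fin N → Sphere N q)) →ₗ[Sphere N q] C.Form :=
  (Fintype.linearCombination (Sphere N q) fun i => C.d (z i)).coprod
    (Fintype.linearCombination (Sphere N q) fun i => C.d (zs i))

theorem ofCoordinates_apply (w : (Fin N → Sphere N q) × (Fin N → Sphere N q)) :
    C.ofCoordinates w = ∑ i, w.1 i •> C.d (z i) + ∑ i, w.2 i •> C.d (zs i) := rfl

theorem d_z_mem (i : Fin N) : C.d (z i) ∈ LinearMap.range C.ofCoordinates :=
  ⟨(Pi.single i 1, 0), by simp [ofCoordinates]⟩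

theorem d_zs_mem (i : Fin N) : C.d (zs i) ∈ LinearMap.range C.ofCoordinates :=
  ⟨(0, Pi.single i 1), by simp [ofCoordinates]⟩

theorem ofCoordinates_right (w : (Fin N → Sphere N q) × (Fin N → Sphere N q)) (x : Sphere N q) :
    C.ofCoordinates w <• x =
      ∑ i, w.1 i •> (C.d (z i) <• x) + ∑ i, w.2 i •> (C.d (zs i) <• x) := by
  rw [ofCoordinates_apply, smul_add, Finset.smul_sum, Finset.smul_sum]
  simp_rw [smul_comm _ (MulOpposite.op x)]

variable {C} {κ : CalcName}

theorem smul_mem_range (c : ℂ) {ω : C.Form} (h : ω ∈ LinearMap.range C.ofCoordinates) :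
    c • ω ∈ LinearMap.range C.ofCoordinates :=
  ((LinearMap.range C.ofCoordinates).restrictScalars ℂ).smul_mem c h

theorem Hcomb_mem (c : ℂ × ℂ) : C.Hcomb c ∈ LinearMap.range C.ofCoordinates :=
  add_mem (smul_mem_range _ (sum_mem fun i _ => Submodule.smul_mem _ _ (C.d_zs_mem i)))
    (smul_mem_range _ (sum_mem fun i _ =>
      smul_mem_range _ (Submodule.smul_mem _ _ (C.d_z_mem i))))

/-- The bimodule relations rewrite a right multiple of `dz_k` or `dz_k^*` by a generator as a left
combination of such differentials, so their left span is a sub-bimodule. -/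
theorem IsCalculus.right_mem (h : C.IsCalculus κ) (x : Sphere N q) :
    ∀ ω ∈ LinearMap.range C.ofCoordinates, ω <• x ∈ LinearMap.range C.ofCoordinates := by
  have key : ∀ x : Sphere N q,
      (∀ i, C.d (z i) <• x ∈ LinearMap.range C.ofCoordinates) →
      (∀ i, C.d (zs i) <• x ∈ LinearMap.range C.ofCoordinates) →
      ∀ ω ∈ LinearMap.range C.ofCoordinates, ω <• x ∈ LinearMap.range C.ofCoordinates := by
    rintro x h1 h2 _ ⟨w, rfl⟩
    rw [ofCoordinates_right]
    exact add_mem (sum_mem fun i _ => Submodule.smul_mem _ _ (h1 i))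
      (sum_mem fun i _ => Submodule.smul_mem _ _ (h2 i))
  have hz : ∀ (x : Sphere N q) i, x •> C.d (z i) ∈ LinearMap.range C.ofCoordinates :=
    fun x i => Submodule.smul_mem _ _ (C.d_z_mem i)
  have hs : ∀ (x : Sphere N q) i, x •> C.d (zs i) ∈ LinearMap.range C.ofCoordinates :=
    fun x i => Submodule.smul_mem _ _ (C.d_zs_mem i)
  have hH : ∀ (x : Sphere N q) c, x •> C.Hcomb c ∈ LinearMap.range C.ofCoordinates :=
    fun x c => Submodule.smul_mem _ _ (Hcomb_mem c)
  have sum : ∀ (c : Fin N → Fin N → ℂ) (f : Fin N → Fin N → C.Form),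
      (∀ s t, f s t ∈ LinearMap.range C.ofCoordinates) →
      ∑ s, ∑ t, c s t • f s t ∈ LinearMap.range C.ofCoordinates :=
    fun c f hf => sum_mem fun s _ => sum_mem fun t _ => smul_mem_range _ (hf s t)
  induction x using sphere_induction with
  | scalar c =>
    intro ω hω
    have : ω <• (algebraMap ℂ (Sphere N q) c) = c • ω := algebraMap_smul (Sphere N q)ᵐᵒᵖ c ω
    rw [this]
    exact smul_mem_range c hω
  | hz l =>
    refine key _ (fun k => ?_) fun k => ?_
    · rw [h.dzz]
      exact add_mem (add_mem (smul_mem_range _ (sum _ _ fun s t => hz _ _))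
        (smul_mem_range _ (hz _ _))) (smul_mem_range _ (hH _ _))
    · rw [h.dsz]
      exact add_mem (add_mem (add_mem (smul_mem_range _ (sum _ _ fun s t => hs _ _))
        (smul_mem_range _ (hz _ _))) (smul_mem_range _ (hH _ _))) (smul_mem_range _ (Hcomb_mem _))
  | hzs l =>
    refine key _ (fun k => ?_) fun k => ?_
    · rw [h.dzs]
      exact add_mem (add_mem (add_mem (smul_mem_range _ (sum _ _ fun s t => hz _ _))
        (smul_mem_range _ (hs _ _))) (smul_mem_range _ (hH _ _))) (smul_mem_range _ (Hcomb_mem _))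
    · rw [h.dss]
      exact add_mem (add_mem (smul_mem_range _ (sum _ _ fun s t => hs _ _))
        (smul_mem_range _ (hs _ _))) (smul_mem_range _ (hH _ _))
  | add x y hx hy =>
    intro ω hω
    rw [MulOpposite.op_add, add_smul]
    exact add_mem (hx ω hω) (hy ω hω)
  | mul x y hx hy =>
    intro ω hω
    rw [MulOpposite.op_mul, mul_smul]
    exact hy _ (hx ω hω)

/-- The one-forms `dz_i`, `dz_i^*` generate a calculus of type `κ` as a left module. -/
theorem IsCalculus.ofCoordinates_surjective (h : C.IsCalculus κ) :
    Function.Surjective C.ofCoordinates := by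
  rw [← LinearMap.range_eq_top, eq_top_iff]
  have hd : ∀ x, C.d x ∈ LinearMap.range C.ofCoordinates := by
    intro x
    induction x using sphere_induction with
    | scalar c => rw [d_algebraMap]; exact zero_mem _
    | hz i => exact C.d_z_mem i
    | hzs i => exact C.d_zs_mem i
    | add x y hx hy => rw [map_add]; exact add_mem hx hy
    | mul x y hx hy =>
      rw [C.leibniz]
      exact add_mem (h.right_mem y _ hx) (Submodule.smul_mem _ _ hy)
  have hle : Submodule.span ℂ {ω : C.Form | ∃ x y : Sphere N q, ω = x •> C.d y} ≤
      (LinearMap.range C.ofCoordinates).restrictScalars ℂ := by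
    rw [Submodule.span_le]
    rintro _ ⟨x, y, rfl⟩
    exact Submodule.smul_mem (LinearMap.range C.ofCoordinates) x (hd y)
  rw [C.span_eq_top] at hle
  exact fun ω _ => hle (Submodule.mem_top (x := ω))

end LeftCoordinates

/-! ### Calculi of the other types are not inner -/

section NotInner

variable {n : ℕ} {q : ℂ} {C : FODC.{0, v} (Sphere (n + 2) q)} {κ : CalcName}

theorem IsCalculus.not_isInner (hq : q ≠ 0) (h : C.IsCalculus κ) (hκ : ¬ κ.IsTilde) :
    ¬ C.IsInner := by
  obtain ⟨α, β, hαβ, hc⟩ := κ.exists_compatible (n + 2) hq hκ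
  obtain ⟨χ, χ', -, -, hz, hs, hz', hs', -, -⟩ := exists_twisted_derivation n hq α β
  let g : ((Fin (n + 2) → Sphere (n + 2) q) × (Fin (n + 2) → Sphere (n + 2) q)) →ₗ[ℂ] ℂ :=
    { toFun := fun w => χ (w.1 1) * α + χ (w.2 1) * β
      map_add' := fun w w' => by
        simp only [Prod.fst_add, Prod.snd_add, Pi.add_apply, map_add]; ring
      map_smul' := fun c w => by
        simp only [Prod.smul_fst, Prod.smul_snd, Pi.smul_apply, map_smul, smul_eq_mul,
          RingHom.id_apply]
        ring }
  have hg : ∀ w, g w = χ (w.1 1) * α + χ (w.2 1) * β := fun w => rfl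
  -- By the exactness of the left relations, the kernel of the coordinate map consists of the
  -- coordinates of `p H₀`. Their entries at index 1 are multiples of `p z₂^*` and `p z₂`, which `χ`
  -- kills, so `g` descends.
  obtain ⟨f, hf⟩ := exists_functional_of_surjective (C.ofCoordinates.restrictScalars ℂ)
    h.ofCoordinates_surjective g (by
      intro w hw
      obtain ⟨p, hp⟩ := (h.relations w.1 w.2).1 hw
      rw [LinearMap.mem_ker, hg, (hp 1).1, (hp 1).2]
      simp [hz, hs])
  replace hf : ∀ w, f (C.ofCoordinates w) = χ (w.1 1) * α + χ (w.2 1) * β := hf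
  have hl : ∀ x ω, f (x •> ω) = χ x * f ω := by
    intro x ω
    obtain ⟨w, rfl⟩ := h.ofCoordinates_surjective ω
    rw [← map_smul, hf, hf]
    simp only [Prod.smul_fst, Prod.smul_snd, Pi.smul_apply, smul_eq_mul, map_mul]
    ring
  have hT : C.IsTwisted f χ α β :=
    { left := hl
      χ_z := hz
      χ_zs := hs
      d_z := fun i => by
        have := hf (Pi.single i 1, 0)
        simpa [ofCoordinates, Pi.single_apply, apply_ite χ, eq_comm] using this
      d_zs := fun i => by
        have := hf (0, Pi.single i 1)
        simpa [ofCoordinates, Pi.single_apply, apply_ite χ, eq_comm] using this }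
  -- By left multiplicativity, right multiplicativity need only be tested on `dz_i` and `dz_i^*`;
  -- for a generator `x` the bimodule relations then decide it.
  have key : ∀ x : Sphere (n + 2) q, (∀ i, f (C.d (z i) <• x) = χ' x * f (C.d (z i))) →
      (∀ i, f (C.d (zs i) <• x) = χ' x * f (C.d (zs i))) →
      ∀ ω, f (ω <• x) = χ' x * f ω := by
    intro x h1 h2 ω
    obtain ⟨w, rfl⟩ := h.ofCoordinates_surjective ω
    rw [ofCoordinates_right, ofCoordinates_apply]
    simp only [map_add, map_sum, hl, h1, h2, mul_add, Finset.mul_sum, mul_left_comm (χ' x)]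
  have hr : ∀ x ω, f (ω <• x) = χ' x * f ω := by
    intro x
    induction x using sphere_induction with
    | scalar c =>
      intro ω
      have : ω <• (algebraMap ℂ (Sphere (n + 2) q) c) = c • ω :=
        algebraMap_smul (Sphere (n + 2) q)ᵐᵒᵖ c ω
      rw [this, map_smul, AlgHom.commutes]
      rfl
    | hz l =>
      refine key _ (fun k => ?_) fun k => ?_
      · rw [h.dzz, hT.rhsZZ hc, hz', hT.d_z]
      · rw [h.dsz, hT.rhsSZ hc, hz', hT.d_zs]
    | hzs l =>
      refine key _ (fun k => ?_) fun k => ?_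
      · rw [h.dzs, hT.rhsZS hc, hs', hT.d_z]
      · rw [h.dss, hT.rhsSS hc, hs', hT.d_zs]
    | add x y hx hy => intro ω; rw [MulOpposite.op_add, add_smul, map_add, hx, hy, map_add, add_mul]
    | mul x y hx hy => intro ω; rw [MulOpposite.op_mul, mul_smul, hy, hx, map_mul]; ring
  rcases hαβ with hα | hβ
  · exact C.not_isInner_of_functional f χ χ' hl hr (z 1) (by simp [hz, hz'])
      (by simpa [hT.d_z] using hα)
  · exact C.not_isInner_of_functional f χ χ' hl hr (zs 1) (by simp [hs, hs'])
      (by simpa [hT.d_zs] using hβ)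

end NotInner

end FODC

theorem calculus_not_isInner (n : ℕ) {q : ℂ} (hq : q ≠ 0) {κ : CalcName} (hκ : ¬ κ.IsTilde) :
    ¬ (calculus (n + 2) q κ).IsInner := by
  obtain ⟨α, β, hαβ, hc⟩ := κ.exists_compatible (n + 2) hq hκ
  obtain ⟨χ, χ', δ, hδ, hz, hs, hz', hs', hδz, hδs⟩ := exists_twisted_derivation n hq α β
  obtain ⟨f, hl, hr, hd⟩ := FODC.exists_functional_universal χ χ' δ hδ
  have hT : (FODC.universal (Sphere (n + 2) q)).IsTwisted f χ α β :=
    { left := hl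
      χ_z := hz
      χ_zs := hs
      d_z := fun i => (hd _).trans (hδz i)
      d_zs := fun i => (hd _).trans (hδs i) }
  -- `f` takes equal values on both sides of each bimodule relation and vanishes on `H₀`.
  have hS : ∀ ω ∈ {ω | (FODC.universal (Sphere (n + 2) q)).DefiningForm κ ω}, f ω = 0 := by
    intro ω hω
    cases hω with
    | rel => exact hT.Hcomb _
    | dzz k l => rw [map_sub, hr, hT.rhsZZ hc, hz', hT.d_z, sub_self]
    | dss k l => rw [map_sub, hr, hT.rhsSS hc, hs', hT.d_zs, sub_self]
    | dzs k l => rw [map_sub, hr, hT.rhsZS hc, hs', hT.d_z, sub_self]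
    | dsz k l => rw [map_sub, hr, hT.rhsSZ hc, hz', hT.d_zs, sub_self]
  rcases hαβ with hα | hβ
  · exact FODC.quotient_not_isInner_of_functional _ _ f χ χ' hl hr hS (z 1) (by simp [hz, hz'])
      (by simpa [hT.d_z] using hα)
  · exact FODC.quotient_not_isInner_of_functional _ _ f χ χ' hl hr hS (zs 1) (by simp [hs, hs'])
      (by simpa [hT.d_zs] using hβ)

end QuantumSphere

end

theorem mainTheorem5 (N : ℕ) (hN : 2 ≤ N) (q : ℝ) (hq₀ : q ≠ 0) (hq₁ : q ≠ 1) (hq₂ : q ≠ -1) :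
    -- the calculi of the first family are inner, by an explicit multiple of `H₊`
    (∀ l : ℂ, (QuantumSphere.CalcName.tilde l).Admissible (q : ℂ) →
      (QuantumSphere.calculus N (q : ℂ) (.tilde l)).IsInnerBy
        ((((q : ℂ) ^ 2)⁻¹ * l - 1)⁻¹ • (QuantumSphere.calculus N (q : ℂ) (.tilde l)).Hplus) ∧
      ∀ C : QuantumSphere.FODC.{0, v} (QuantumSphere.Sphere N (q : ℂ)),
        C.IsCalculus (.tilde l) →
          C.IsInnerBy ((((q : ℂ) ^ 2)⁻¹ * l - 1)⁻¹ • C.Hplus)) ∧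
    -- none of the other calculi is inner
    (∀ κ : QuantumSphere.CalcName, κ.Admissible (q : ℂ) → ¬ κ.IsTilde →
      ¬ (QuantumSphere.calculus N (q : ℂ) κ).IsInner ∧
      ∀ C : QuantumSphere.FODC.{0, v} (QuantumSphere.Sphere N (q : ℂ)),
        C.IsCalculus κ → ¬ C.IsInner) := by
  have hq : (q : ℂ) ≠ 0 := Complex.ofReal_ne_zero.2 hq₀
  -- `N ≥ 2` supplies the second coordinate, `z 1`, on whose differentials the obstruction lives.
  obtain ⟨n, rfl⟩ : ∃ n, N = n + 2 := ⟨N - 2, by omega⟩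
  refine ⟨fun l hl => ⟨?_, fun C hC => C.tilde_isInnerBy hq hl hC.dsz hC.dss⟩,
    fun κ _ hκ => ⟨QuantumSphere.calculus_not_isInner n hq hκ, fun C hC => hC.not_isInner hq hκ⟩⟩
  exact QuantumSphere.FODC.tilde_isInnerBy _ hq hl (QuantumSphere.calculus_dsz _ _ _)
    (QuantumSphere.calculus_dss _ _ _)
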